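/- Let $K$ be a field, let $S=K[x_1,\dots,x_n]$, and let $Q$ be a poset on the set of variables $\{x_1,\dots,x_n\}$. A monomial ideal $I\subseteq S$ is called $Q$-Borel if, whenever $u\in I$ is a monomial, $x_i\mid u$ and $x_j\le_Q x_i$, the monomial $x_j\cdot (u/x_i)$ belongs to $I$. For a monomial $m\in S$, let $Q(m)$ denote the smallest $Q$-Borel ideal containing $m$. For an ideal $I\subseteq S$ and an integer $d\ge 1$, let $$I^{(d)}=\bigcap_{P\in\operatorname{ass}(I)}\left(I^dS_P\cap S\right),$$ where $\operatorname{ass}(I)$ is the set of all associated primes of $I$ (the prime ideals of the form $I:\langle f\rangle$ with $f\in S$) and $S_P$ is the localization of $S$ at $P$ (the empty intersection is $S$). Then, for every monomial $m\in S$, the ideal $I=Q(m)$ satisfies $I^{(d)}=I^d$ for all $d\ge 1$. -/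

import Mathlib

open MvPolynomial

namespace QBorel

/-- The ideal `I` of `K[x_i : i ∈ σ]` is a monomial ideal: it is generated by monomials
`x^α` (`α : σ →₀ ℕ` is the exponent vector). -/
def IsMonomialIdeal {K : Type*} [Field K] {σ : Type*} (I : Ideal (MvPolynomial σ K)) : Prop :=
  ∃ A : Set (σ →₀ ℕ), I = Ideal.span ((fun α => monomial α (1 : K)) '' A)

/-- The partial order on the index set `σ` of the variables plays the role of the poset `Q`
(`x_j ≤_Q x_i` is `j ≤ i`). A monomial ideal `I` is `Q`-Borel if for every monomial
`x^α ∈ I`, every `x_i` dividing `x^α` and every `x_j ≤_Q x_i`, the monomial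
`x_j * (x^α / x_i)` lies in `I`. -/
def IsQBorel {K : Type*} [Field K] {σ : Type*} [PartialOrder σ]
    (I : Ideal (MvPolynomial σ K)) : Prop :=
  IsMonomialIdeal I ∧
    ∀ (α : σ →₀ ℕ) (i j : σ), monomial α (1 : K) ∈ I → 0 < α i → j ≤ i →
      monomial (Finsupp.single j 1 + (α - Finsupp.single i 1)) (1 : K) ∈ I

/-- The intersection of all `Q`-Borel ideals that contain the monomials `x^α`, `α ∈ X`; it is
the smallest such ideal, see `isLeast_qBorelSpan`. -/
noncomputable def qBorelSpan (K : Type*) [Field K] {σ : Type*} [PartialOrder σ] (X : Set (σ →₀ ℕ)) :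
    Ideal (MvPolynomial σ K) :=
  sInf {I | IsQBorel I ∧ ∀ α ∈ X, monomial α (1 : K) ∈ I}

/-- The principal `Q`-Borel ideal `Q(x^m)`. -/
noncomputable def principalQBorel (K : Type*) [Field K] {σ : Type*} [PartialOrder σ] (m : σ →₀ ℕ) :
    Ideal (MvPolynomial σ K) :=
  qBorelSpan K {m}

/-- The `d`-th symbolic power `I^(d) = ⋂_{P ∈ ass(I)} (I^d R_P ∩ R)`, over all associated
primes `P` of `I` (embedded ones included), of an ideal of a Noetherian ring `R`. Over such a ring
`Submodule.IsAssociatedPrime I P` says that `P` is prime and `P = I : ⟨f⟩` for some `f`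
(`Submodule.isAssociatedPrime_iff`). -/
noncomputable def symbolicPower {R : Type*} [CommRing R] [IsNoetherianRing R]
    (I : Ideal R) (d : ℕ) : Ideal R :=
  ⨅ P : {P : Ideal R // Submodule.IsAssociatedPrime I P},
    haveI : P.1.IsPrime := P.2.toIsPrime
    ((I ^ d).map (algebraMap R (Localization.AtPrime P.1))).comap
      (algebraMap R (Localization.AtPrime P.1))

theorem isMonomialIdeal_iff {K : Type*} [Field K] {σ : Type*} (I : Ideal (MvPolynomial σ K)) :
    IsMonomialIdeal I ↔ ∀ f ∈ I, ∀ α ∈ f.support, monomial α (1 : K) ∈ I := by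
  constructor
  · rintro ⟨A, rfl⟩ f hf α hα
    obtain ⟨β, hβ, hle⟩ := mem_ideal_span_monomial_image.1 hf α hα
    refine mem_ideal_span_monomial_image.2 fun γ hγ => ⟨β, hβ, ?_⟩
    have hγα : γ = α := by
      exact Finset.mem_singleton.1 (support_monomial_subset hγ)
    exact hγα ▸ hle
  · intro h
    refine ⟨{α | monomial α (1 : K) ∈ I}, le_antisymm (fun f hf => ?_) ?_⟩
    · exact mem_ideal_span_monomial_image.2 fun α hα => ⟨α, h f hf α hα, le_rfl⟩
    · rw [Ideal.span_le]
      rintro _ ⟨α, hα, rfl⟩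
      exact hα

/-- `qBorelSpan K X` is itself `Q`-Borel, hence the smallest `Q`-Borel ideal containing `X`. -/
theorem isLeast_qBorelSpan (K : Type*) [Field K] {σ : Type*} [PartialOrder σ]
    (X : Set (σ →₀ ℕ)) :
    IsLeast {I : Ideal (MvPolynomial σ K) | IsQBorel I ∧ ∀ α ∈ X, monomial α (1 : K) ∈ I}
      (qBorelSpan K X) := by
  refine ⟨⟨⟨(isMonomialIdeal_iff _).2 ?_, ?_⟩, ?_⟩, fun I hI => sInf_le hI⟩
  · intro f hf α hα
    refine Submodule.mem_sInf.2 fun I hI => ?_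
    exact (isMonomialIdeal_iff I).1 hI.1.1 f (Submodule.mem_sInf.1 hf I hI) α hα
  · intro α i j hα hi hij
    refine Submodule.mem_sInf.2 fun I hI => ?_
    exact hI.1.2 α i j (Submodule.mem_sInf.1 hα I hI) hi hij
  · intro α hα
    exact Submodule.mem_sInf.2 fun I hI => hI.2 α hα

end QBorel

/-! Write `p_i = (x_j : j ≤ i)`. Then `Q(x^m) = ∏ p_i ^ m_i`. By Hall's theorem, `f` lies in this
product exactly when, for every lower set `D`, each monomial of `f` has `D`-degree at least that of
`x^m` (`mem_lowerProd_iff`). The `d`-th power replaces `m` by `d • m`, so it suffices to derive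
these inequalities from membership in the symbolic power. Let `A` be the part of `D` in the support
of `m`. If `A` is indecomposable, its lower hull generates an associated prime of `Q(x^m)`
(`isAssociatedPrime_coordPrime`), and order along that prime is unaffected by multipliers outside
it. Otherwise `A` splits into parts with disjoint lower hulls, whose inequalities add up. -/

namespace QBorel

section Weight

variable {σ : Type*}

/-- The degree of the monomial `x^α` in the variables `x_j`, `j ∈ D`. -/
def weightOn (D : Finset σ) (α : σ →₀ ℕ) : ℕ := ∑ j ∈ D, α j

theorem weightOn_add (D : Finset σ) (α β : σ →₀ ℕ) :
    weightOn D (α + β) = weightOn D α + weightOn D β := by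
  simp [weightOn, Finset.sum_add_distrib]

theorem weightOn_single [DecidableEq σ] (D : Finset σ) (i : σ) :
    weightOn D (Finsupp.single i 1) = if i ∈ D then 1 else 0 := by
  simp [weightOn, Finsupp.single_apply]

theorem weightOn_mono {D E : Finset σ} (h : D ⊆ E) (α : σ →₀ ℕ) :
    weightOn D α ≤ weightOn E α :=
  Finset.sum_le_sum_of_subset h

end Weight

/-! ### Order along a coordinate prime -/

section Grading

variable {K : Type*} [Field K] {σ : Type*}

theorem monomial_add_single (w : σ →₀ ℕ) (j : σ) :
    monomial (w + Finsupp.single j 1) (1 : K) = monomial w 1 * X j := by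
  rw [X, monomial_mul, mul_one]

open Classical in
/-- The homomorphism `K[x] → K[x][T]` with `x_j ↦ T x_j` for `j ∈ D` and `x_j ↦ x_j` otherwise;
the `T`-adic valuation of the image is the order along the ideal `(x_j : j ∈ D)`. -/
noncomputable def gradingHom (K : Type*) [Field K] {σ : Type*} (D : Finset σ) :
    MvPolynomial σ K →ₐ[K] Polynomial (MvPolynomial σ K) :=
  aeval fun j => if j ∈ D then Polynomial.X * Polynomial.C (X j) else Polynomial.C (X j)

theorem gradingHom_X_of_mem {D : Finset σ} {j : σ} (hj : j ∈ D) :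
    gradingHom K D (X j) = Polynomial.X * Polynomial.C (X j) := by
  simp [gradingHom, hj]

theorem gradingHom_monomial (D : Finset σ) (α : σ →₀ ℕ) (c : K) :
    gradingHom K D (monomial α c) =
      Polynomial.X ^ weightOn D α * Polynomial.C (monomial α c) := by
  classical
  have key : ∀ j, (if j ∈ D then Polynomial.X * Polynomial.C (X j) else Polynomial.C (X j) :
      Polynomial (MvPolynomial σ K)) =
      (if j ∈ D then Polynomial.X else 1) * Polynomial.C (X j) := by
    intro j; split_ifs <;> simp
  have hX : (α.prod fun j k => (if j ∈ D then Polynomial.X else 1 :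
      Polynomial (MvPolynomial σ K)) ^ k) = Polynomial.X ^ weightOn D α := by
    rw [weightOn, ← Finset.prod_pow_eq_pow_sum,
      Finsupp.prod_of_support_subset (s := α.support ∪ D) _ Finset.subset_union_left _ (by simp)]
    rw [← Finset.prod_subset (Finset.subset_union_right (s₁ := α.support) (s₂ := D))]
    · exact Finset.prod_congr rfl fun j hj => by simp [hj]
    · intro j _ hj; simp [hj]
  rw [gradingHom, aeval_monomial]
  simp_rw [key, mul_pow]
  rw [Finsupp.prod_mul, hX, monomial_eq, map_mul]
  simp only [Finsupp.prod, map_prod, map_pow]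
  rw [show algebraMap K (Polynomial (MvPolynomial σ K)) c = Polynomial.C (C c) from rfl]
  ring

theorem coeff_coeff_gradingHom (D : Finset σ) (f : MvPolynomial σ K) (α : σ →₀ ℕ) :
    ((gradingHom K D f).coeff (weightOn D α)).coeff α = f.coeff α := by
  classical
  induction f using MvPolynomial.induction_on' with
  | monomial β c =>
    rw [gradingHom_monomial, Polynomial.coeff_X_pow_mul', coeff_monomial]
    by_cases h : β = α
    · subst h; simp
    · split_ifs
      · rw [Polynomial.coeff_C]; split_ifs <;> simp [coeff_monomial, h]
      · simp
  | add p q hp hq => simp [hp, hq]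

theorem X_pow_dvd_gradingHom_iff (D : Finset σ) (k : ℕ) (f : MvPolynomial σ K) :
    Polynomial.X ^ k ∣ gradingHom K D f ↔ ∀ α ∈ f.support, k ≤ weightOn D α := by
  constructor
  · intro h α hα
    by_contra! hk
    have := coeff_coeff_gradingHom D f α
    rw [Polynomial.X_pow_dvd_iff.1 h _ hk, coeff_zero] at this
    exact mem_support_iff.1 hα this.symm
  · intro h
    rw [f.as_sum, map_sum]
    refine Finset.dvd_sum fun α hα => ?_
    rw [gradingHom_monomial]
    exact (pow_dvd_pow _ (h α hα)).mul_right _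

/-- The prime ideal `(x_j : j ∈ D)`, as the set of polynomials of positive order. -/
noncomputable def coordPrime (K : Type*) [Field K] {σ : Type*} (D : Finset σ) :
    Ideal (MvPolynomial σ K) :=
  (Ideal.span {Polynomial.X}).comap (gradingHom K D)

theorem mem_coordPrime_iff {D : Finset σ} {f : MvPolynomial σ K} :
    f ∈ coordPrime K D ↔ Polynomial.X ∣ gradingHom K D f := by
  rw [coordPrime, Ideal.mem_comap, Ideal.mem_span_singleton]

theorem coordPrime_isPrime (D : Finset σ) : (coordPrime K D).IsPrime := by
  have : (Ideal.span {(Polynomial.X : Polynomial (MvPolynomial σ K))}).IsPrime :=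
    (Ideal.span_singleton_prime Polynomial.X_ne_zero).2 Polynomial.prime_X
  exact Ideal.comap_isPrime _ _

theorem coordPrime_eq_span (D : Finset σ) :
    coordPrime K D = Ideal.span (X '' (D : Set σ)) := by
  apply le_antisymm
  · intro f hf
    rw [mem_coordPrime_iff, ← pow_one Polynomial.X, X_pow_dvd_gradingHom_iff] at hf
    refine mem_ideal_span_X_image.2 fun α hα => ?_
    obtain ⟨j, hj, h⟩ := Finset.exists_ne_zero_of_sum_ne_zero
      (Nat.one_le_iff_ne_zero.1 (hf α hα))
    exact ⟨j, hj, h⟩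
  · rw [Ideal.span_le]
    rintro _ ⟨j, hj, rfl⟩
    rw [SetLike.mem_coe, mem_coordPrime_iff, gradingHom_X_of_mem hj]
    exact dvd_mul_right _ _

end Grading

/-! ### Products of lower primes and the degree criterion -/

section LowerProd

variable {K : Type*} [Field K] {σ : Type*} [PartialOrder σ]

/-- The prime ideal `(x_j : j ≤ i)`. -/
noncomputable def lowerPrime (K : Type*) [Field K] {σ : Type*} [PartialOrder σ] (i : σ) :
    Ideal (MvPolynomial σ K) :=
  Ideal.span (X '' Set.Iic i)

theorem X_mem_lowerPrime {i j : σ} (h : j ≤ i) : (X j : MvPolynomial σ K) ∈ lowerPrime K i :=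
  Ideal.subset_span ⟨j, h, rfl⟩

variable [Fintype σ]

/-- The product `∏ i, (x_j : j ≤ i) ^ b i`. -/
noncomputable def lowerProd (K : Type*) [Field K] {σ : Type*} [PartialOrder σ] [Fintype σ]
    (b : σ →₀ ℕ) : Ideal (MvPolynomial σ K) :=
  ∏ i, lowerPrime K i ^ b i

theorem lowerProd_add (b c : σ →₀ ℕ) :
    lowerProd K (b + c) = lowerProd K b * lowerProd K c := by
  simp [lowerProd, pow_add, Finset.prod_mul_distrib]

theorem lowerProd_single (i : σ) : lowerProd K (Finsupp.single i 1) = lowerPrime K i := by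
  classical
  rw [lowerProd, Finset.prod_eq_single i] <;> simp +contextual [eq_comm]

theorem lowerProd_smul (d : ℕ) (b : σ →₀ ℕ) : lowerProd K (d • b) = lowerProd K b ^ d := by
  simp [lowerProd, ← Finset.prod_pow, ← pow_mul, mul_comm]

theorem monomial_self_mem_lowerProd (b : σ →₀ ℕ) : monomial b (1 : K) ∈ lowerProd K b := by
  rw [monomial_eq, C_1, one_mul, Finsupp.prod_fintype _ _ (by simp)]
  exact Ideal.prod_mem_prod fun i _ => Ideal.pow_mem_pow (X_mem_lowerPrime le_rfl) _

/-- Since `D` is a lower set, each factor with index in `D` lies in `coordPrime K D`; the other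
factors are discarded. -/
theorem X_pow_dvd_gradingHom_of_mem_lowerProd {b : σ →₀ ℕ} {f : MvPolynomial σ K}
    (hf : f ∈ lowerProd K b) {D : Finset σ} (hD : IsLowerSet (D : Set σ)) :
    Polynomial.X ^ weightOn D b ∣ gradingHom K D f := by
  classical
  have h1 : ∀ i ∈ D, lowerPrime K i ≤ coordPrime K D := by
    intro i hi
    rw [coordPrime_eq_span]
    exact Ideal.span_mono (Set.image_mono fun j hj => hD hj hi)
  have h2 : lowerProd K b ≤ coordPrime K D ^ weightOn D b := by
    rw [lowerProd, weightOn, ← Finset.prod_pow_eq_pow_sum,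
      ← Finset.prod_sdiff (Finset.subset_univ D)]
    exact Ideal.mul_le_right.trans
      (Finset.prod_le_prod' fun i hi => Ideal.pow_right_mono (h1 i hi) _)
  have h3 : (coordPrime K D).map (gradingHom K D) ≤ Ideal.span {Polynomial.X} :=
    Ideal.map_comap_le
  have h4 := Ideal.mem_map_of_mem (gradingHom K D) (h2 hf)
  rw [Ideal.map_pow] at h4
  have h5 := Ideal.pow_right_mono h3 _ h4
  rwa [Ideal.span_singleton_pow, Ideal.mem_span_singleton] at h5

/-- Hall's marriage theorem, as a membership criterion. -/
theorem monomial_mem_lowerProd {b α : σ →₀ ℕ}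
    (h : ∀ D : Finset σ, IsLowerSet (D : Set σ) → weightOn D b ≤ weightOn D α) :
    monomial α (1 : K) ∈ lowerProd K b := by
  classical
  -- Match each of the `b i` factors `p_i` with its own occurrence of some `x_j`, `j ≤ i`, in `x^α`.
  let t : (Σ i, Fin (b i)) → Finset (Σ j, Fin (α j)) := fun p => {q | q.1 ≤ p.1}
  have hall : ∀ s : Finset (Σ i, Fin (b i)), s.card ≤ (s.biUnion t).card := by
    intro s
    -- The neighbours of `s` are all occurrences in `x^α` of variables from `D`, so Hall's condition
    -- follows from the degree inequality for `D`.
    let D : Finset σ := {j | ∃ p ∈ s, j ≤ p.1}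
    have hD : IsLowerSet (D : Set σ) := by
      intro j k hkj hj
      simp only [D, Finset.coe_filter, Finset.mem_univ, true_and, Set.mem_ofPred_eq] at hj ⊢
      obtain ⟨p, hp, hjp⟩ := hj
      exact ⟨p, hp, hkj.trans hjp⟩
    calc s.card ≤ (D.sigma fun i => (Finset.univ : Finset (Fin (b i)))).card :=
          Finset.card_le_card fun p hp => by
            simp only [Finset.mem_sigma, Finset.mem_univ, and_true, D, Finset.mem_filter, true_and]
            exact ⟨p, hp, le_rfl⟩
      _ = weightOn D b := by simp [weightOn]
      _ ≤ weightOn D α := h D hD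
      _ = (D.sigma fun j => (Finset.univ : Finset (Fin (α j)))).card := by simp [weightOn]
      _ ≤ (s.biUnion t).card := Finset.card_le_card fun q hq => by
            simpa [D, t] using hq
  obtain ⟨g, hg, hgt⟩ := (Finset.all_card_le_biUnion_card_iff_exists_injective t).1 hall
  have hmem : (∏ p, X (g p).1 : MvPolynomial σ K) ∈ lowerProd K b := by
    have : lowerProd K b = ∏ p : (Σ i, Fin (b i)), lowerPrime K p.1 := by
      rw [Fintype.prod_sigma]; simp [lowerProd]
    rw [this]
    exact Ideal.prod_mem_prod fun p _ => X_mem_lowerPrime (by simpa [t] using hgt p)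
  have hmon : monomial α (1 : K) = ∏ q : (Σ j, Fin (α j)), X q.1 := by
    rw [monomial_eq, C_1, one_mul, Finsupp.prod_fintype _ _ (by simp), Fintype.prod_sigma]
    simp
  refine Ideal.mem_of_dvd _ ?_ hmem
  rw [hmon, ← Finset.prod_image (s := Finset.univ) (g := g)
    (f := fun q : (Σ j, Fin (α j)) => (X q.1 : MvPolynomial σ K)) hg.injOn]
  exact Finset.prod_dvd_prod_of_subset _ _ _ (Finset.subset_univ _)

theorem mem_lowerProd_iff {b : σ →₀ ℕ} {f : MvPolynomial σ K} :
    f ∈ lowerProd K b ↔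
      ∀ α ∈ f.support, ∀ D : Finset σ, IsLowerSet (D : Set σ) → weightOn D b ≤ weightOn D α := by
  constructor
  · intro hf α hα D hD
    exact (X_pow_dvd_gradingHom_iff D _ f).1 (X_pow_dvd_gradingHom_of_mem_lowerProd hf hD) α hα
  · intro h
    rw [f.as_sum]
    refine Ideal.sum_mem _ fun α hα => ?_
    rw [show monomial α (f.coeff α) = C (f.coeff α) * monomial α 1 by simp [C_mul_monomial]]
    exact Ideal.mul_mem_left _ _ (monomial_mem_lowerProd (h α hα))

theorem monomial_mem_lowerProd_iff {b α : σ →₀ ℕ} :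
    monomial α (1 : K) ∈ lowerProd K b ↔
      ∀ D : Finset σ, IsLowerSet (D : Set σ) → weightOn D b ≤ weightOn D α := by
  rw [mem_lowerProd_iff]
  classical
  simp [support_monomial]

theorem isQBorel_lowerProd (b : σ →₀ ℕ) : IsQBorel (lowerProd K b) := by
  classical
  constructor
  · rw [isMonomialIdeal_iff]
    intro f hf α hα
    exact monomial_mem_lowerProd (mem_lowerProd_iff.1 hf α hα)
  · intro α i j hα hi hji
    rw [monomial_mem_lowerProd_iff] at hα ⊢
    intro D hD
    refine (hα D hD).trans ?_
    have hsub : α = Finsupp.single i 1 + (α - Finsupp.single i 1) :=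
      (add_tsub_cancel_of_le (by simpa [Finsupp.single_le_iff] using Nat.succ_le_of_lt hi)).symm
    rw [hsub, weightOn_add, ← hsub, weightOn_add, weightOn_single, weightOn_single]
    gcongr
    split_ifs with h1 h2 <;> simp
    exact h2 (hD hji h1)

/-- Peel off one factor `p_i` at a time: a Borel move trades `x_i` for `x_j`, which is then absorbed
into the spectator `γ`. Hence `γ` must be arbitrary in the induction. -/
theorem monomial_mul_mem_of_mem_lowerProd {L : Ideal (MvPolynomial σ K)} (hL : IsQBorel L)
    (b : σ →₀ ℕ) : ∀ γ : σ →₀ ℕ, monomial (b + γ) (1 : K) ∈ L →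
      ∀ g ∈ lowerProd K b, monomial γ (1 : K) * g ∈ L := by
  classical
  have step : ∀ (b : σ →₀ ℕ) (i : σ), (∀ γ : σ →₀ ℕ, monomial (b + γ) (1 : K) ∈ L →
      ∀ g ∈ lowerProd K b, monomial γ (1 : K) * g ∈ L) →
      ∀ γ : σ →₀ ℕ, monomial (Finsupp.single i 1 + b + γ) (1 : K) ∈ L →
      ∀ g ∈ lowerProd K (Finsupp.single i 1 + b), monomial γ (1 : K) * g ∈ L := by
    intro b i ih γ hγ g hg
    rw [lowerProd_add, lowerProd_single] at hg
    induction hg using Submodule.mul_induction_on' with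
    | mem_mul_mem p hp q hq =>
      induction hp using Submodule.span_induction with
      | mem p hp =>
        obtain ⟨j, hj, rfl⟩ := hp
        have hmove := hL.2 _ i j hγ (by simp) hj
        rw [add_assoc, add_tsub_cancel_left, add_left_comm] at hmove
        have := ih _ hmove q hq
        rwa [show monomial (Finsupp.single j 1 + γ) (1 : K) = monomial γ 1 * X j by
          rw [add_comm, monomial_add_single], mul_assoc] at this
      | zero => simp
      | add x y _ _ hx hy => rw [add_mul, mul_add]; exact L.add_mem hx hy
      | smul a x _ hx =>
        rw [smul_eq_mul, mul_assoc, mul_left_comm]; exact L.mul_mem_left _ hx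
    | add x _ y _ hx hy => rw [mul_add]; exact L.add_mem hx hy
  induction b using Finsupp.induction with
  | zero => intro γ hγ g _; rw [zero_add] at hγ; exact L.mul_mem_right _ hγ
  | single_add i n b _ _ ih =>
    clear * - step ih
    induction n with
    | zero => simpa using ih
    | succ n ihn =>
      have := step _ i ihn
      rwa [← add_assoc, ← Finsupp.single_add, add_comm 1 n] at this

theorem principalQBorel_eq_lowerProd (m : σ →₀ ℕ) : principalQBorel K m = lowerProd K m := by
  apply le_antisymm
  · refine (isLeast_qBorelSpan K {m}).2 ⟨isQBorel_lowerProd m, ?_⟩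
    rintro _ rfl
    exact monomial_self_mem_lowerProd _
  · intro g hg
    obtain ⟨hB, hm⟩ := (isLeast_qBorelSpan K {m}).1
    have := monomial_mul_mem_of_mem_lowerProd hB m 0 (by simpa using hm m rfl) g hg
    rwa [show monomial (0 : σ →₀ ℕ) (1 : K) = 1 from rfl, one_mul] at this

end LowerProd

/-! ### Associated primes and symbolic powers -/

section AssociatedPrime

variable {K : Type*} [Field K] {σ : Type*} [PartialOrder σ] [Fintype σ]

open Classical in
/-- The lower set generated by `A`. -/
noncomputable def lowerHull (A : Finset σ) : Finset σ := {j | ∃ i ∈ A, j ≤ i}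

theorem mem_lowerHull {A : Finset σ} {j : σ} : j ∈ lowerHull A ↔ ∃ i ∈ A, j ≤ i := by
  simp [lowerHull]

theorem isLowerSet_lowerHull (A : Finset σ) : IsLowerSet (lowerHull A : Set σ) := by
  intro j k hkj hj
  obtain ⟨i, hi, hji⟩ := mem_lowerHull.1 hj
  exact mem_lowerHull.2 ⟨i, hi, hkj.trans hji⟩

theorem subset_lowerHull (A : Finset σ) : A ⊆ lowerHull A :=
  fun i hi => mem_lowerHull.2 ⟨i, hi, le_rfl⟩

theorem lowerHull_subset {A D : Finset σ} (hD : IsLowerSet (D : Set σ)) (h : A ⊆ D) :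
    lowerHull A ⊆ D := by
  intro j hj
  obtain ⟨i, hi, hji⟩ := mem_lowerHull.1 hj
  exact hD hji (h hi)

/-- `A` is not a union of two nonempty parts whose lower hulls are disjoint. -/
def Indecomposable (A : Finset σ) : Prop :=
  A.Nonempty ∧ ∀ B ⊂ A, B.Nonempty → ∃ e ∈ lowerHull B, ∃ i ∈ A, i ∉ B ∧ e ≤ i

/-- A socle-type monomial for a product of distinct primes `(x_j : j ≤ i)`. -/
theorem exists_socle_monomial {A : Finset σ} (hA : Indecomposable A) :
    ∃ w : σ →₀ ℕ, weightOn Finset.univ w + 1 = A.card ∧ ∀ j ∈ lowerHull A,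
      monomial (w + Finsupp.single j 1) (1 : K) ∈ lowerProd K (∑ i ∈ A, Finsupp.single i 1) := by
  classical
  let W : Finset σ → Prop := fun B => ∃ w : σ →₀ ℕ, weightOn Finset.univ w + 1 = B.card ∧
    ∀ j ∈ lowerHull B,
      monomial (w + Finsupp.single j 1) (1 : K) ∈ lowerProd K (∑ i ∈ B, Finsupp.single i 1)
  obtain ⟨i₀, hi₀⟩ := hA.1
  have hbase : W {i₀} := by
    refine ⟨0, by simp [weightOn], fun j hj => ?_⟩
    obtain ⟨i, hi, hji⟩ := mem_lowerHull.1 hj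
    rw [Finset.mem_singleton] at hi
    subst hi
    rw [Finset.sum_singleton, lowerProd_single, zero_add]
    exact X_mem_lowerPrime hji
  obtain ⟨B, hB, hmax⟩ := Finset.exists_max_image
    {B ∈ A.powerset | B.Nonempty ∧ W B} Finset.card ⟨{i₀}, by simp [hi₀, hbase]⟩
  -- A maximal `B ≠ A` can be enlarged: indecomposability gives `x_e` below both `B` and a new `i`,
  -- and `w * x_e` serves for `insert i B`.
  simp only [Finset.mem_filter, Finset.mem_powerset] at hB hmax
  obtain ⟨hBA, hBne, w, hw, hwB⟩ := hB
  by_cases hBeq : B = A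
  · subst hBeq; exact ⟨w, hw, hwB⟩
  exfalso
  obtain ⟨e, he, i, hiA, hiB, hei⟩ := hA.2 B (hBA.ssubset_of_ne hBeq) hBne
  have := hmax (insert i B) ⟨Finset.insert_subset hiA hBA, Finset.insert_nonempty _ _,
    w + Finsupp.single e 1, ?_, ?_⟩
  · rw [Finset.card_insert_of_notMem hiB] at this; omega
  · rw [Finset.card_insert_of_notMem hiB, weightOn_add, weightOn_single]
    simp; omega
  · intro j hj
    rw [Finset.sum_insert hiB, lowerProd_add, lowerProd_single]
    obtain ⟨k, hk, hjk⟩ := mem_lowerHull.1 hj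
    -- If `j ≤ i`, then `x_j` goes to `p_i` and `x_e` to the old product; otherwise they swap roles.
    rcases Finset.mem_insert.1 hk with rfl | hk
    · rw [monomial_add_single, mul_comm]
      exact Ideal.mul_mem_mul (hwB e he) (X_mem_lowerPrime hjk)
    · rw [add_right_comm, monomial_add_single, mul_comm]
      exact Ideal.mul_mem_mul (hwB j (mem_lowerHull.2 ⟨k, hk, hjk⟩)) (X_mem_lowerPrime hei)

/-- The prime is the colon by `x^(w + c)`, with `w` the socle monomial and `c` what remains of `m`
after removing one copy of each index in `A`. -/
theorem isAssociatedPrime_coordPrime {A : Finset σ} (hA : Indecomposable A) {m : σ →₀ ℕ}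
    (hm : ∀ i ∈ A, m i ≠ 0) :
    Submodule.IsAssociatedPrime (lowerProd K m) (coordPrime K (lowerHull A)) := by
  classical
  obtain ⟨w, hw, hwA⟩ := exists_socle_monomial (K := K) hA
  set s : σ →₀ ℕ := ∑ i ∈ A, Finsupp.single i 1 with hs
  have hsapp : ∀ i, s i = if i ∈ A then 1 else 0 := by
    intro i; simp [hs, Finsupp.finsetSum_apply, Finsupp.single_apply]
  obtain ⟨c, rfl⟩ : ∃ c, m = s + c := by
    refine exists_add_of_le fun i => ?_
    rw [hsapp]
    split_ifs with h
    · exact Nat.one_le_iff_ne_zero.2 (hm i h)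
    · exact Nat.zero_le _
  have hws : weightOn (lowerHull A) s = A.card := by
    simp [weightOn, hsapp, Finset.inter_eq_right.2 (subset_lowerHull A)]
  -- `w` has total degree `A.card - 1`, so its order is too small, and a multiplier outside the
  -- prime cannot raise it.
  have hlt : weightOn (lowerHull A) (w + c) < weightOn (lowerHull A) (s + c) := by
    have := weightOn_mono (Finset.subset_univ (lowerHull A)) w
    rw [weightOn_add, weightOn_add, hws]
    omega
  refine Submodule.isAssociatedPrime_iff.2
    ⟨coordPrime_isPrime _, monomial (w + c) 1, le_antisymm ?_ ?_⟩
  · rw [coordPrime_eq_span, Ideal.span_le]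
    rintro _ ⟨j, hj, rfl⟩
    rw [SetLike.mem_coe, Submodule.mem_colon_singleton, smul_eq_mul, mul_comm,
      ← monomial_add_single, add_right_comm, lowerProd_add,
      ← one_mul (1 : K), ← monomial_mul]
    exact Ideal.mul_mem_mul (hwA j hj) (monomial_self_mem_lowerProd c)
  · intro g hg
    rw [Submodule.mem_colon_singleton, smul_eq_mul] at hg
    by_contra hgP
    rw [mem_coordPrime_iff] at hgP
    have h1 := X_pow_dvd_gradingHom_of_mem_lowerProd hg (isLowerSet_lowerHull A)
    rw [map_mul] at h1
    have h2 := (X_pow_dvd_gradingHom_iff _ _ _).1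
      (Polynomial.prime_X.pow_dvd_of_dvd_mul_left _ hgP h1) (w + c)
      (by simp [support_monomial])
    omega

theorem exists_mul_mem_of_mem_symbolicPower {R : Type*} [CommRing R] [IsNoetherianRing R]
    {I P : Ideal R} (hP : Submodule.IsAssociatedPrime I P) {d : ℕ} {f : R}
    (hf : f ∈ symbolicPower I d) : ∃ s ∉ P, s * f ∈ I ^ d := by
  have := hP.toIsPrime
  have h := (Submodule.mem_iInf _).1 hf ⟨P, hP⟩
  rw [Ideal.mem_comap] at h
  obtain ⟨s, hs, h⟩ := (IsLocalization.algebraMap_mem_map_algebraMap_iff P.primeCompl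
    (Localization.AtPrime P) _ _).1 h
  exact ⟨s, hs, h⟩

theorem le_symbolicPower {R : Type*} [CommRing R] [IsNoetherianRing R] (I : Ideal R) (d : ℕ) :
    I ^ d ≤ symbolicPower I d :=
  le_iInf fun _ => Ideal.le_comap_map

theorem smul_weightOn_le_of_mem_symbolicPower {m : σ →₀ ℕ} {d : ℕ} {f : MvPolynomial σ K}
    (hf : f ∈ symbolicPower (lowerProd K m) d) {α : σ →₀ ℕ} (hα : α ∈ f.support)
    (D : Finset σ) (hD : IsLowerSet (D : Set σ)) :
    weightOn D (d • m) ≤ weightOn D α := by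
  classical
  induction D using Finset.strongInduction with
  | H D ih =>
    set A : Finset σ := {i ∈ D | m i ≠ 0} with hAdef
    have hAD : A ⊆ D := Finset.filter_subset _ _
    have hsum : ∀ E ⊆ D, A ⊆ E → weightOn E (d • m) = weightOn D (d • m) := by
      intro E hED hAE
      refine Finset.sum_subset hED fun i hi hiE => ?_
      have : m i = 0 := by
        by_contra h
        exact hiE (hAE (by simp [hAdef, hi, h]))
      simp [this]
    -- For empty `A` the bound is `0`. This covers `m = 0`, where there are no associated primes.
    rcases A.eq_empty_or_nonempty with hA | hA
    · rw [← hsum ∅ (by simp) (by simp [hA])]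
      simp [weightOn]
    by_cases hind : Indecomposable A
    · obtain ⟨s, hs, hsf⟩ := exists_mul_mem_of_mem_symbolicPower
        (isAssociatedPrime_coordPrime hind (m := m) (by simp [hAdef])) hf
      rw [← lowerProd_smul] at hsf
      have h1 := X_pow_dvd_gradingHom_of_mem_lowerProd hsf (isLowerSet_lowerHull A)
      rw [map_mul] at h1
      rw [mem_coordPrime_iff] at hs
      have h2 := (X_pow_dvd_gradingHom_iff _ _ _).1
        (Polynomial.prime_X.pow_dvd_of_dvd_mul_left _ hs h1) α hα
      rw [hsum _ (lowerHull_subset hD hAD) (subset_lowerHull A)] at h2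
      exact h2.trans (weightOn_mono (lowerHull_subset hD hAD) α)
    · simp only [Indecomposable, hA, true_and] at hind
      push Not at hind
      obtain ⟨B, hBA, hB, hsep⟩ := hind
      obtain ⟨i, hiA, hiB⟩ := Finset.exists_of_ssubset hBA
      obtain ⟨k, hk⟩ := hB
      have hdisj : Disjoint (lowerHull B) (lowerHull (A \ B)) := by
        rw [Finset.disjoint_left]
        intro e heB heC
        obtain ⟨l, hl, hel⟩ := mem_lowerHull.1 heC
        rw [Finset.mem_sdiff] at hl
        exact hsep e heB l hl.1 hl.2 hel
      have hi : i ∈ lowerHull (A \ B) := subset_lowerHull _ (Finset.mem_sdiff.2 ⟨hiA, hiB⟩)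
      have hk' : k ∈ lowerHull B := subset_lowerHull _ hk
      have hBD := lowerHull_subset hD (hBA.1.trans hAD)
      have hCD := lowerHull_subset hD ((Finset.sdiff_subset (s := A) (t := B)).trans hAD)
      -- Both hulls are proper in `D`, each missing an element of the other.
      have h1 := ih (lowerHull B) ⟨hBD, fun h =>
        Finset.disjoint_left.1 hdisj (h (hAD hiA)) hi⟩ (isLowerSet_lowerHull _)
      have h2 := ih (lowerHull (A \ B)) ⟨hCD, fun h =>
        Finset.disjoint_left.1 hdisj hk' (h (hBD hk'))⟩ (isLowerSet_lowerHull _)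
      have hunion : ∀ β : σ →₀ ℕ, weightOn (lowerHull B ∪ lowerHull (A \ B)) β =
          weightOn (lowerHull B) β + weightOn (lowerHull (A \ B)) β :=
        fun β => Finset.sum_union hdisj
      have hUD := Finset.union_subset hBD hCD
      rw [← hsum _ hUD, hunion]
      · refine (add_le_add h1 h2).trans ?_
        rw [← hunion]
        exact weightOn_mono hUD α
      · intro l hl
        by_cases hlB : l ∈ B
        · exact Finset.mem_union_left _ (subset_lowerHull _ hlB)
        · exact Finset.mem_union_right _ (subset_lowerHull _ (Finset.mem_sdiff.2 ⟨hl, hlB⟩))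

end AssociatedPrime

end QBorel

theorem theorem3 {K : Type*} [Field K] {σ : Type*} [Finite σ] [PartialOrder σ]
    (m : σ →₀ ℕ) (d : ℕ) (hd : 1 ≤ d) :
    QBorel.symbolicPower (QBorel.principalQBorel K m) d = QBorel.principalQBorel K m ^ d := by
  cases nonempty_fintype σ
  refine le_antisymm (fun f hf => ?_) (QBorel.le_symbolicPower _ d)
  rw [QBorel.principalQBorel_eq_lowerProd] at hf ⊢
  rw [← QBorel.lowerProd_smul, QBorel.mem_lowerProd_iff]
  exact fun α hα D hD => QBorel.smul_weightOn_le_of_mem_symbolicPower hf hα D hD
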